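/- An arena is a directed graph on a countable (possibly infinite) vertex set $V$, in which every vertex has an outgoing edge, together with a partition of $V$ into the vertices controlled by Eve and those controlled by Adam. A play $\pi=\pi_0\pi_1\ldots$ is an infinite path, formed by letting the owner of the current vertex choose the next edge. A strategy of a player maps every finite history ending in a vertex of that player to a successor of this vertex; it is winning from a set $U\subseteq V$ if every play starting in $U$ and consistent with it is won by that player, and the winning set of a player is the set of vertices from which the player has a winning strategy. A memory structure $(M,m_0,\mu)$ consists of a set $M$ of memory states, an initial state $m_0\in M$ and an update function $\mu$ that maps the current memory state and the edge just taken to the next memory state. A strategy uses this memory structure if its moves depend only on the current vertex and the current memory state; it is positional if its moves depend only on the current vertex. For $F\subseteq V$ and $N\in\mathbb N$, the uniform Büchi game with bound $N$ is the game in which Eve wins a play $\pi$ if and only if $\limsup_{k}\mathrm{dist}_k(\pi,F)\le N$, where $\mathrm{dist}_k(\pi,F)=\inf\{k'-k \mid k'\ge k,\ \pi_{k'}\in F\}\in\mathbb N\cup\{\infty\}$ (with $\inf\emptyset=\infty$), and Adam wins otherwise. Proposition (Strategy complexity for uniform Büchi games). For every arena, every $F\subseteq V$ and every $N\in\mathbb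 N$, the following hold in the uniform Büchi game with bound $N$: 1. Eve has a positional strategy that is winning from her whole winning set. 2. Adam has a strategy that is winning from his whole winning set and uses a single memory structure with $N+1$ memory states. Moreover: 3. In general, Adam needs at least $N-1$ memory states, even over finite arenas: for every $N\ge 2$ there are a finite arena, a set $F$ of its vertices and a vertex $v_0$ in Adam's winning set such that every memory structure with finitely many states that is used by some strategy of Adam winning from $v_0$ has at least $N-1$ memory states. -/

import Mathlib

open Filter

universe u w

/-- The two players. -/
inductive Player : Type where
  | eve : Player
  | adam : Player

/-- An arena on the vertex set `V`: a directed graph without dead-ends, together with a partition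
of its vertices, given by the player `owner v` who controls the vertex `v`. -/
structure Arena (V : Type u) where
  owner : V → Player
  Edge : V → V → Prop
  exists_edge : ∀ v, ∃ v', Edge v v'

namespace Arena

variable {V : Type u}

/-- A strategy for the player `p`: `next h v` is the move prescribed at the current vertex `v`
after the finite history `h`, the list of the earlier vertices, the most recent one first.
Its values at vertices that `p` does not control are irrelevant. -/
structure Strategy (A : Arena V) (p : Player) where
  next : List V → V → V
  legal : ∀ h v, A.owner v = p → A.Edge v (next h v)

/-- The move made at `v` after the history `h` when both strategies are followed. -/
def move (A : Arena V) (σ : A.Strategy Player.eve) (τ : A.Strategy Player.adam)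
    (h : List V) (v : V) : V :=
  match A.owner v with
  | Player.eve => σ.next h v
  | Player.adam => τ.next h v

/-- The history before time `n` (most recent vertex first) and the vertex at time `n`,
when `σ` and `τ` are played from `v₀`. -/
def stage (A : Arena V) (σ : A.Strategy Player.eve) (τ : A.Strategy Player.adam) (v₀ : V) :
    ℕ → List V × V
  | 0 => ([], v₀)
  | n + 1 =>
    let s := stage A σ τ v₀ n
    (s.2 :: s.1, A.move σ τ s.1 s.2)

/-- The unique play `π(v₀, σ, τ)`. -/
def play (A : Arena V) (σ : A.Strategy Player.eve) (τ : A.Strategy Player.adam) (v₀ : V) (n : ℕ) :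
    V :=
  (A.stage σ τ v₀ n).2

/-- Eve's strategy `σ` is winning from `U` for the condition `Ω`. -/
def EveWins (A : Arena V) (Ω : Set (ℕ → V)) (σ : A.Strategy Player.eve) (U : Set V) : Prop :=
  ∀ v₀ ∈ U, ∀ τ : A.Strategy Player.adam, A.play σ τ v₀ ∈ Ω

/-- Adam's strategy `τ` is winning from `U` in the game where Eve's condition is `Ω`
(so that Adam's condition is the complement of `Ω`). -/
def AdamWins (A : Arena V) (Ω : Set (ℕ → V)) (τ : A.Strategy Player.adam) (U : Set V) : Prop :=
  ∀ v₀ ∈ U, ∀ σ : A.Strategy Player.eve, A.play σ τ v₀ ∉ Ω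

/-- The vertices from which Eve has a winning strategy. -/
def eveWinningSet (A : Arena V) (Ω : Set (ℕ → V)) : Set V :=
  {v | ∃ σ : A.Strategy Player.eve, A.EveWins Ω σ {v}}

/-- The vertices from which Adam has a winning strategy. -/
def adamWinningSet (A : Arena V) (Ω : Set (ℕ → V)) : Set V :=
  {v | ∃ τ : A.Strategy Player.adam, A.AdamWins Ω τ {v}}

end Arena

/-- A memory structure with set of memory states `M`, which reads the edges taken.
The value of `update` at pairs of vertices that are not edges is irrelevant. -/
structure MemoryStructure (V : Type u) (M : Type w) where
  init : M
  update : M → V × V → M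

/-- The memory state reached at the current vertex after a history (most recent vertex first). -/
def MemoryStructure.state {V : Type u} {M : Type w} (μ : MemoryStructure V M) : List V → V → M
  | [], _ => μ.init
  | v :: h, v' => μ.update (μ.state h v) (v, v')

namespace Arena.Strategy

variable {V : Type u} {A : Arena V} {p : Player}

/-- The strategy relies on the memory structure `μ`: its moves are given by a next-move function
of the current vertex and the current memory state only. -/
def UsesMemory {M : Type w} (σ : A.Strategy p) (μ : MemoryStructure V M) : Prop :=
  ∃ ν : V → M → V, ∀ h v, A.owner v = p → σ.next h v = ν v (μ.state h v)

/-- The strategy is positional (memoryless): its moves depend on the current vertex only. -/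
def IsPositional (σ : A.Strategy p) : Prop :=
  ∃ f : V → V, ∀ h v, A.owner v = p → σ.next h v = f v

end Arena.Strategy

/-- The waiting time `dist_k(π, F) = inf {k' - k | k' ≥ k, π k' ∈ F}`, which is `⊤` if `F` is
not visited from time `k` on. -/
noncomputable def waitingTime {V : Type u} (F : Set V) (π : ℕ → V) (k : ℕ) : ℕ∞ :=
  sInf {d | ∃ k', k ≤ k' ∧ π k' ∈ F ∧ d = ((k' - k : ℕ) : ℕ∞)}

/-- The uniform Büchi condition with Büchi set `F` and bound `N`. -/
def uniformBuchi {V : Type u} (F : Set V) (N : ℕ) : Set (ℕ → V) :=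
  {π | limsup (fun k => waitingTime F π k) atTop ≤ (N : ℕ∞)}

/-!
Eve's objective is measured by ordinal ranks, the least fixed point of a value iteration in which
she minimizes and Adam maximizes. A rank of the uniform Büchi game with bound `N` is read as
`(N + 1) * a + c` with `c ≤ N`, where `c` bounds the number of steps until `F` is visited. Visiting
`F` allows Eve to restart `c`, and so does lowering `a`, but the latter happens only finitely often
along a play. Hence always moving to a successor that realizes the rank is a positional strategy
which is winning wherever the rank is not `⊤`.

Adam can keep the play among the vertices of rank `⊤`. There, from every vertex and for every
budget `c ≤ N`, he can force a visit to more than `c` vertices outside `F` before the next one in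
`F`: the vertices and budgets for which he fails would yield ranks `(N + 1) * a + c` for a quotient
`a` above all finite ranks. Moving closer to this goal takes only the knowledge of the remaining
budget, for which `N + 1` memory states suffice, and Adam starts over once he has reached it.

For the lower bound, the right pick of Adam depends on the remaining budget. If he never picks `j`,
because his memory is too small, then Eve resets at once after a pick below `j` and takes the
detour after a pick above `j`, and both are in time.
-/

namespace Player

theorem ne_eve_iff {p : Player} : p ≠ eve ↔ p = adam := by cases p <;> simp

end Player

section UniformBuchi

variable {V : Type u} {F : Set V} {N : ℕ} {π : ℕ → V}

theorem waitingTime_lt_iff {k d : ℕ} :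
    waitingTime F π k < d ↔ ∃ j < d, π (k + j) ∈ F := by
  simp only [waitingTime, sInf_lt_iff]
  constructor
  · rintro ⟨_, ⟨k', hk, hF, rfl⟩, hlt⟩
    exact ⟨k' - k, by exact_mod_cast hlt, by rwa [Nat.add_sub_cancel' hk]⟩
  · rintro ⟨j, hj, hF⟩
    exact ⟨_, ⟨k + j, Nat.le_add_right k j, hF, rfl⟩, by simpa using hj⟩

theorem mem_uniformBuchi_iff :
    π ∈ uniformBuchi F N ↔ ∀ᶠ k in atTop, ∃ j ≤ N, π (k + j) ∈ F := by
  have waitingTime_le_iff (k : ℕ) : waitingTime F π k ≤ N ↔ ∃ j ≤ N, π (k + j) ∈ F := by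
    rw [← ENat.lt_add_one_iff (ENat.natCast_ne_top N)]
    exact_mod_cast (waitingTime_lt_iff (d := N + 1)).trans (by simp only [Nat.lt_succ_iff])
  simp only [uniformBuchi, Set.mem_ofPred_eq, ← waitingTime_le_iff]
  constructor
  · intro h
    have h_lt : limsup (waitingTime F π) atTop < N + 1 :=
      (ENat.lt_add_one_iff (ENat.natCast_ne_top N)).2 h
    exact (eventually_lt_of_limsup_lt h_lt).mono fun k hk => Order.le_of_lt_add_one hk
  · exact fun h => limsup_le_of_le (by isBoundedDefault) h

theorem mem_uniformBuchi_of_counter (c : ℕ → ℕ) (hN : ∀ᶠ k in atTop, c k ≤ N)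
    (hc : ∀ᶠ k in atTop, π k ∈ F ∨ c (k + 1) < c k) : π ∈ uniformBuchi F N := by
  obtain ⟨k₀, hk₀⟩ := eventually_atTop.1 hc
  have visit (n : ℕ) : ∀ k ≥ k₀, c k ≤ n → ∃ j ≤ n, π (k + j) ∈ F := by
    induction n with
    | zero =>
      intro k hk hcn
      exact ⟨0, le_rfl, (hk₀ k hk).resolve_right (by omega)⟩
    | succ n ih =>
      intro k hk hcn
      rcases hk₀ k hk with hF | hlt
      · exact ⟨0, Nat.zero_le _, hF⟩
      · obtain ⟨j, hj, hF⟩ := ih (k + 1) (by omega) (by omega)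
        exact ⟨j + 1, by omega, by rwa [add_comm j 1, ← add_assoc]⟩
  rw [mem_uniformBuchi_iff]
  filter_upwards [hN, eventually_ge_atTop k₀] with k hcN hk using visit N k hk hcN

end UniformBuchi

/-- A game on positions `P` in which the minimizer wants to make an ordinal rank finite (`≠ ⊤`)
and the opponent wants to prevent this. The owner of a position `x` picks a move from it, and if
this move has rank `o`, then the rank offered to `x` is `lift x o`. -/
structure RankingGame (P : Type u) where
  IsMin : P → Prop
  moves : P → Set P
  lift : P → Ordinal.{u} →o Ordinal.{u}

namespace RankingGame

variable {P : Type u} (G : RankingGame P)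

open Classical in
/-- One round of value iteration: the minimizer takes the infimum, and the opponent the supremum,
of the ranks offered by the moves. In particular, a player without a move loses. -/
noncomputable def valueStep : (P → WithTop Ordinal.{u}) →o (P → WithTop Ordinal.{u}) where
  toFun ρ x :=
    if G.IsMin x then ⨅ y : G.moves x, (ρ y).map (G.lift x)
    else ⨆ y : G.moves x, (ρ y).map (G.lift x)
  monotone' ρ ρ' h x := by
    have lift_mono (y : P) : (ρ y).map (G.lift x) ≤ (ρ' y).map (G.lift x) :=
      WithTop.monotone_map_iff.2 (G.lift x).monotone (h y)
    dsimp only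
    split_ifs
    · exact iInf_mono fun y => lift_mono y
    · exact iSup_mono fun y => lift_mono y

/-- The optimal ranks, the least solution of the optimality equations. -/
noncomputable def rank : P → WithTop Ordinal.{u} :=
  G.valueStep.lfp

variable {G} {x y : P}

theorem valueStep_of_isMin (hx : G.IsMin x) (ρ : P → WithTop Ordinal.{u}) :
    G.valueStep ρ x = ⨅ y : G.moves x, (ρ y).map (G.lift x) :=
  if_pos hx

theorem valueStep_of_not_isMin (hx : ¬ G.IsMin x) (ρ : P → WithTop Ordinal.{u}) :
    G.valueStep ρ x = ⨆ y : G.moves x, (ρ y).map (G.lift x) :=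
  if_neg hx

theorem valueStep_le {ρ : P → WithTop Ordinal.{u}} {o : WithTop Ordinal.{u}}
    (hmin : G.IsMin x → ∃ y ∈ G.moves x, (ρ y).map (G.lift x) ≤ o)
    (hopp : ¬ G.IsMin x → ∀ y ∈ G.moves x, (ρ y).map (G.lift x) ≤ o) : G.valueStep ρ x ≤ o := by
  by_cases hx : G.IsMin x
  · obtain ⟨y, hy, hle⟩ := hmin hx
    rw [valueStep_of_isMin hx]
    exact iInf_le_of_le ⟨y, hy⟩ hle
  · rw [valueStep_of_not_isMin hx]
    exact iSup_le fun y => hopp hx y y.2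

variable (G) in
theorem valueStep_rank : G.valueStep G.rank = G.rank :=
  G.valueStep.map_lfp

theorem rank_le {ρ : P → WithTop Ordinal.{u}} (h : G.valueStep ρ ≤ ρ) : G.rank ≤ ρ :=
  G.valueStep.lfp_le h

theorem exists_map_lift_rank_le (hx : G.IsMin x) (htop : G.rank x ≠ ⊤) :
    ∃ y ∈ G.moves x, (G.rank y).map (G.lift x) ≤ G.rank x := by
  have rank_eq : G.rank x = ⨅ y : G.moves x, (G.rank y).map (G.lift x) := by
    conv_lhs => rw [← G.valueStep_rank, valueStep_of_isMin hx]
  rcases isEmpty_or_nonempty (G.moves x) with _ | _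
  · exact absurd (rank_eq.trans (iInf_of_empty _)) htop
  · obtain ⟨y, hy⟩ := ciInf_mem fun y : G.moves x => (G.rank y).map (G.lift x)
    exact ⟨y, y.2, (hy.trans rank_eq.symm).le⟩

theorem map_lift_rank_le (hx : ¬ G.IsMin x) (hy : y ∈ G.moves x) :
    (G.rank y).map (G.lift x) ≤ G.rank x := by
  conv_rhs => rw [← G.valueStep_rank, valueStep_of_not_isMin hx]
  exact le_iSup (fun y : G.moves x => (G.rank y).map (G.lift x)) ⟨y, hy⟩

theorem rank_ne_top_iff_of_isMin (hx : G.IsMin x) :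
    G.rank x ≠ ⊤ ↔ ∃ y ∈ G.moves x, G.rank y ≠ ⊤ := by
  simp [← congrFun G.valueStep_rank x, valueStep_of_isMin hx, iInf_eq_top]

theorem rank_ne_top_iff_of_not_isMin (hx : ¬ G.IsMin x) :
    G.rank x ≠ ⊤ ↔ ∀ y ∈ G.moves x, G.rank y ≠ ⊤ := by
  refine ⟨fun htop y hy hytop => htop (top_le_iff.1 ?_), fun h => ?_⟩
  · simpa [hytop] using map_lift_rank_le hx hy
  · choose! o ho using fun y hy => WithTop.ne_top_iff_exists.1 (h y hy)
    have bdd : BddAbove (Set.range fun y : G.moves x => G.lift x (o y)) :=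
      Ordinal.bddAbove_of_small
    have lift_eq (y : G.moves x) : (G.rank y).map (G.lift x) = G.lift x (o y) := by
      rw [← ho y y.2, WithTop.map_coe]
    rw [← G.valueStep_rank, valueStep_of_not_isMin hx]
    simp only [lift_eq]
    exact (WithTop.iSup_coe_lt_top.2 bdd).ne

end RankingGame

section BuchiLift

/-- Rounding an ordinal down to a multiple of `N + 1`. -/
noncomputable def blockFloor (N : ℕ) : Ordinal.{u} →o Ordinal.{u} where
  toFun o := (N + 1 : ℕ) * (o / (N + 1 : ℕ))
  monotone' _ _ h := mul_le_mul_right (Ordinal.div_le_left h _) _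

open Classical in
/-- The rank offered to a vertex `v` in the uniform Büchi game by a successor of rank
`o = (N + 1) * a + c` with `c ≤ N`: the remainder `c` counts the steps within which `F` is visited
unless the quotient `a` drops, so that it restarts at `0` if `v ∈ F` and increases otherwise. -/
noncomputable def buchiLift {V : Type u} (F : Set V) (N : ℕ) (v : V) :
    Ordinal.{u} →o Ordinal.{u} :=
  if v ∈ F then blockFloor N else ⟨Order.succ, Order.succ_mono⟩

variable {V : Type u} {F : Set V} {N : ℕ} {v : V} {o o' : Ordinal.{u}}

theorem buchiLift_of_mem (hv : v ∈ F) :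
    buchiLift F N v o = (N + 1 : ℕ) * (o / (N + 1 : ℕ)) := by
  simp [buchiLift, hv, blockFloor]

theorem buchiLift_of_notMem (hv : v ∉ F) : buchiLift F N v o = Order.succ o := by
  simp [buchiLift, hv]

theorem div_le_div_of_buchiLift_le (h : buchiLift F N v o' ≤ o) :
    o' / (N + 1 : ℕ) ≤ o / (N + 1 : ℕ) := by
  by_cases hv : v ∈ F
  · rwa [buchiLift_of_mem hv, Ordinal.mul_le_iff_le_div (mod_cast N.succ_ne_zero)] at h
  · rw [buchiLift_of_notMem hv, Order.succ_le_iff] at h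
    exact Ordinal.div_le_left h.le _

theorem mod_lt_mod_of_buchiLift_le (h : buchiLift F N v o' ≤ o) (hv : v ∉ F)
    (hdiv : o' / (N + 1 : ℕ) = o / (N + 1 : ℕ)) : o' % (N + 1 : ℕ) < o % (N + 1 : ℕ) := by
  rw [buchiLift_of_notMem hv, Order.succ_le_iff, ← Ordinal.div_add_mod o' (N + 1 : ℕ),
    ← Ordinal.div_add_mod o (N + 1 : ℕ), hdiv] at h
  exact lt_of_add_lt_add_left h

theorem buchiLift_le_of_lt {a : Ordinal.{u}} (h : o < (N + 1 : ℕ) * a) :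
    buchiLift F N v o ≤ (N + 1 : ℕ) * a := by
  by_cases hv : v ∈ F
  · rw [buchiLift_of_mem hv]
    exact (Ordinal.mul_div_le o _).trans h.le
  · rw [buchiLift_of_notMem hv]
    exact Order.succ_le_of_lt h

theorem buchiLift_block_add_le {a : Ordinal.{u}} {c c' : ℕ} (hc' : c' ≤ N)
    (h : v ∈ F ∨ c' < c) :
    buchiLift F N v ((N + 1 : ℕ) * a + c') ≤ (N + 1 : ℕ) * a + c := by
  by_cases hv : v ∈ F
  · rw [buchiLift_of_mem hv, Ordinal.mul_add_div _ (mod_cast N.succ_ne_zero),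
      Ordinal.div_eq_zero_of_lt (mod_cast Nat.lt_succ_of_le hc'), add_zero]
    exact le_self_add
  · rw [buchiLift_of_notMem hv, Order.succ_le_iff]
    exact add_lt_add_right (mod_cast h.resolve_left hv) _

theorem exists_forall_lt_mul_of_eq_coe (ρ : V → WithTop Ordinal.{u}) (N : ℕ) :
    ∃ a : Ordinal.{u}, ∀ v, ∀ o : Ordinal.{u}, ρ v = o → o < (N + 1 : ℕ) * a := by
  refine ⟨⨆ v, Order.succ ((ρ v).untopD 0), fun v o ho => ?_⟩
  calc o < Order.succ ((ρ v).untopD 0) := by rw [ho]; exact Order.lt_succ o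
    _ ≤ ⨆ v, Order.succ ((ρ v).untopD 0) := Ordinal.le_iSup _ v
    _ ≤ _ := Ordinal.le_mul_right _ (mod_cast N.succ_pos)

theorem mem_uniformBuchi_of_buchiLift_le {π : ℕ → V} (o : ℕ → Ordinal.{u})
    (h : ∀ k, buchiLift F N (π k) (o (k + 1)) ≤ o k) : π ∈ uniformBuchi F N := by
  have div_antitone : Antitone fun k => o k / (N + 1 : ℕ) :=
    antitone_nat_of_succ_le fun k => div_le_div_of_buchiLift_le (h k)
  obtain ⟨k₀, div_const⟩ := WellFoundedLT.antitone_chain_condition div_antitone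
  have mod_lt (k : ℕ) : o k % (N + 1 : ℕ) < (N + 1 : ℕ) :=
    Ordinal.mod_lt _ (mod_cast N.succ_ne_zero)
  choose c hc using fun k =>
    Ordinal.lt_omega0.1 ((mod_lt k).trans (Ordinal.natCast_lt_omega0 _))
  refine mem_uniformBuchi_of_counter c (.of_forall fun k => ?_) ?_
  · have hlt := mod_lt k
    rw [hc k] at hlt
    exact Nat.le_of_lt_succ (mod_cast hlt)
  · filter_upwards [eventually_ge_atTop k₀] with k hk
    refine or_iff_not_imp_left.2 fun hF => ?_
    have hlt := mod_lt_mod_of_buchiLift_le (h k) hF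
      ((div_const (k + 1) (by omega)).symm.trans (div_const k hk))
    rw [hc k, hc (k + 1)] at hlt
    exact_mod_cast hlt

end BuchiLift

section Budget

variable {V : Type u} {F : Set V} {N : ℕ}

/-- Adam's goal within one round: a vertex outside `F` is visited when the budget `c`, the number
of further vertices outside `F` that Eve may visit, is used up. -/
def BudgetExceeded (F : Set V) (v : V) (c : ℕ) : Prop :=
  v ∉ F ∧ c = 0

open Classical in
/-- The budget after a visit to `v` with budget `c`: it restarts at `N` when `F` is visited and when
it is exceeded. -/
noncomputable def nextBudget (F : Set V) (N : ℕ) (v : V) (c : ℕ) : ℕ :=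
  if v ∈ F ∨ c = 0 then N else c - 1

/-- The budget at time `k` of the play `π`. -/
noncomputable def budget (F : Set V) (N : ℕ) (π : ℕ → V) : ℕ → ℕ
  | 0 => N
  | k + 1 => nextBudget F N (π k) (budget F N π k)

theorem nextBudget_of_mem {v : V} {c : ℕ} (hv : v ∈ F) : nextBudget F N v c = N :=
  if_pos (.inl hv)

theorem nextBudget_of_notMem {v : V} {c : ℕ} (hv : v ∉ F) (hc : c ≠ 0) :
    nextBudget F N v c = c - 1 :=
  if_neg (not_or.2 ⟨hv, hc⟩)

theorem nextBudget_le {v : V} {c : ℕ} (hc : c ≤ N) : nextBudget F N v c ≤ N := by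
  unfold nextBudget
  split_ifs <;> omega

theorem budget_le (π : ℕ → V) (k : ℕ) : budget F N π k ≤ N := by
  induction k with
  | zero => exact le_rfl
  | succ k ih => exact nextBudget_le ih

theorem notMem_of_add_budget_le {π : ℕ → V} {j k : ℕ} (hjk : j < k)
    (hj : k + budget F N π k ≤ j + N) : π j ∉ F := by
  induction k with
  | zero => omega
  | succ k ih =>
    simp only [budget, nextBudget] at hj
    split_ifs at hj with h
    · omega
    · rcases Nat.lt_succ_iff_lt_or_eq.1 hjk with hlt | rfl
      · exact ih hlt (by omega)
      · exact fun hF => h (.inl hF)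

theorem notMem_uniformBuchi_of_frequently_budgetExceeded {π : ℕ → V}
    (h : ∃ᶠ k in atTop, BudgetExceeded F (π k) (budget F N π k)) : π ∉ uniformBuchi F N := by
  rw [mem_uniformBuchi_iff]
  intro hvisit
  obtain ⟨k₀, hk₀⟩ := eventually_atTop.1 hvisit
  obtain ⟨l, hl, hF, hzero⟩ := frequently_atTop.1 h (k₀ + N)
  obtain ⟨j, hj, hjF⟩ := hk₀ (l - N) (by omega)
  rcases Nat.lt_or_ge (l - N + j) l with hlt | hge
  · have hwithin : l + budget F N π l ≤ l - N + j + N := by omega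
    exact notMem_of_add_budget_le hlt hwithin hjF
  · exact hF ((by omega : l - N + j = l) ▸ hjF)

/-- The memory structure that keeps track of the budget. -/
noncomputable def budgetMemory (F : Set V) (N : ℕ) : MemoryStructure V (Fin (N + 1)) where
  init := Fin.last N
  update c e := ⟨nextBudget F N e.1 c, Nat.lt_succ_of_le (nextBudget_le c.is_le)⟩

end Budget

namespace Arena

variable {V : Type u} {A : Arena V} {F : Set V} {N : ℕ}

section Play

variable {σ : A.Strategy Player.eve} {τ : A.Strategy Player.adam} {v₀ : V} {k : ℕ}

theorem play_succ_of_eve (h : A.owner (A.play σ τ v₀ k) = Player.eve) :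
    A.play σ τ v₀ (k + 1) = σ.next (A.stage σ τ v₀ k).1 (A.play σ τ v₀ k) := by
  simp only [play] at h ⊢
  simp only [stage, move, h]

theorem play_succ_of_adam (h : A.owner (A.play σ τ v₀ k) = Player.adam) :
    A.play σ τ v₀ (k + 1) = τ.next (A.stage σ τ v₀ k).1 (A.play σ τ v₀ k) := by
  simp only [play] at h ⊢
  simp only [stage, move, h]

variable (σ τ v₀ k) in
theorem edge_play : A.Edge (A.play σ τ v₀ k) (A.play σ τ v₀ (k + 1)) := by
  cases h : A.owner (A.play σ τ v₀ k) with
  | eve => exact play_succ_of_eve h ▸ σ.legal _ _ h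
  | adam => exact play_succ_of_adam h ▸ τ.legal _ _ h

variable (σ τ v₀ k) in
theorem state_budgetMemory_eq_budget :
    ((budgetMemory F N).state (A.stage σ τ v₀ k).1 (A.play σ τ v₀ k) : ℕ) =
      budget F N (A.play σ τ v₀) k := by
  induction k with
  | zero => rfl
  | succ k ih => exact congrArg (nextBudget F N (A.play σ τ v₀ k)) ih

end Play

variable (A) in
theorem exists_legal_choice (Q : V → V → Prop) :
    ∃ f : V → V, ∀ v, A.Edge v (f v) ∧ ((∃ v', A.Edge v v' ∧ Q v v') → Q v (f v)) := by
  have exists_move (v : V) : ∃ v', A.Edge v v' ∧ ((∃ v', A.Edge v v' ∧ Q v v') → Q v v') := by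
    by_cases h : ∃ v', A.Edge v v' ∧ Q v v'
    · obtain ⟨v', he, hQ⟩ := h
      exact ⟨v', he, fun _ => hQ⟩
    · obtain ⟨v', he⟩ := A.exists_edge v
      exact ⟨v', he, fun hex => absurd hex h⟩
  choose f hf using exists_move
  exact ⟨f, hf⟩

theorem eveWinningSet_eq_and_adamWinningSet_eq {Ω : Set (ℕ → V)} {σ : A.Strategy Player.eve}
    {τ : A.Strategy Player.adam} {U : Set V} (hσ : A.EveWins Ω σ U) (hτ : A.AdamWins Ω τ Uᶜ) :
    A.eveWinningSet Ω = U ∧ A.adamWinningSet Ω = Uᶜ := by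
  refine ⟨Set.Subset.antisymm ?_ ?_, Set.Subset.antisymm ?_ ?_⟩
  · rintro v ⟨σ', hσ'⟩
    exact by_contra fun hv => hτ v hv σ' (hσ' v rfl τ)
  · rintro v hv
    exact ⟨σ, fun _ hv₀ => hσ _ (hv₀ ▸ hv)⟩
  · rintro v ⟨τ', hτ'⟩ hv
    exact hτ' v rfl σ (hσ v hv τ')
  · rintro v hv
    exact ⟨τ, fun _ hv₀ => hτ _ (hv₀ ▸ hv)⟩

/-- A trap for the player `p`: a set which `p` cannot leave and in which the other player can
stay. -/
def IsTrap (A : Arena V) (p : Player) (L : Set V) : Prop :=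
  ∀ v ∈ L, (A.owner v = p → ∀ v', A.Edge v v' → v' ∈ L) ∧
    (A.owner v ≠ p → ∃ v' ∈ L, A.Edge v v')

/-- The uniform Büchi game as a ranking game of Eve. -/
noncomputable def buchiGame (A : Arena V) (F : Set V) (N : ℕ) : RankingGame V where
  IsMin v := A.owner v = Player.eve
  moves v := {v' | A.Edge v v'}
  lift := buchiLift F N

variable (A F N) in
theorem exists_positional_eveWins :
    ∃ σ : A.Strategy Player.eve, σ.IsPositional ∧
      A.EveWins (uniformBuchi F N) σ {v | (A.buchiGame F N).rank v ≠ ⊤} := by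
  set ρ := (A.buchiGame F N).rank
  obtain ⟨f, hf⟩ := A.exists_legal_choice fun v v' => (ρ v').map (buchiLift F N v) ≤ ρ v
  let σ : A.Strategy Player.eve := ⟨fun _ => f, fun _ v _ => (hf v).1⟩
  refine ⟨σ, ⟨f, fun _ _ _ => rfl⟩, fun v₀ hv₀ τ => ?_⟩
  set π := A.play σ τ v₀
  have rank_step (k : ℕ) (hk : ρ (π k) ≠ ⊤) :
      (ρ (π (k + 1))).map (buchiLift F N (π k)) ≤ ρ (π k) := by
    by_cases ho : A.owner (π k) = Player.eve
    · have hmove : π (k + 1) = f (π k) := play_succ_of_eve ho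
      obtain ⟨v', he, hle⟩ := RankingGame.exists_map_lift_rank_le (G := A.buchiGame F N) ho hk
      exact hmove ▸ (hf (π k)).2 ⟨v', he, hle⟩
    · exact RankingGame.map_lift_rank_le (G := A.buchiGame F N) ho (edge_play σ τ v₀ k)
  have rank_ne_top (k : ℕ) : ρ (π k) ≠ ⊤ := by
    induction k with
    | zero => exact hv₀
    | succ k ih =>
      intro htop
      have hle := rank_step k ih
      rw [htop, WithTop.map_top, top_le_iff] at hle
      exact ih hle
  choose o ho using fun k => WithTop.ne_top_iff_exists.1 (rank_ne_top k)
  refine mem_uniformBuchi_of_buchiLift_le o fun k => ?_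
  have hle := rank_step k (rank_ne_top k)
  rwa [← ho, ← ho, WithTop.map_coe, WithTop.coe_le_coe] at hle

variable (A F N) in
theorem isTrap_eve_rank_eq_top : A.IsTrap Player.eve {v | (A.buchiGame F N).rank v = ⊤} := by
  refine fun v hv => ⟨fun ho v' he => ?_, fun ho => ?_⟩
  · by_contra hv'
    exact (RankingGame.rank_ne_top_iff_of_isMin (G := A.buchiGame F N) ho).2 ⟨v', he, hv'⟩ hv
  · by_contra! hno
    exact (RankingGame.rank_ne_top_iff_of_not_isMin (G := A.buchiGame F N) ho).2
      (fun v' he htop => hno v' htop he) hv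

theorem rank_ne_top_of_counter {S : Set V} (c : V → ℕ) (hc : ∀ v ∈ S, c v ≤ N)
    (heve : ∀ v ∈ S, A.owner v = Player.eve →
      ∃ v' ∈ S, A.Edge v v' ∧ (v ∈ F ∨ c v' < c v))
    (hadam : ∀ v ∈ S, A.owner v = Player.adam → ∀ v', A.Edge v v' →
      (A.buchiGame F N).rank v' ≠ ⊤ ∨ v' ∈ S ∧ (v ∈ F ∨ c v' < c v)) :
    ∀ v ∈ S, (A.buchiGame F N).rank v ≠ ⊤ := by
  classical
  set G := A.buchiGame F N
  obtain ⟨a, rank_lt⟩ := exists_forall_lt_mul_of_eq_coe G.rank N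
  -- On `S`, infinite ranks can be replaced by ranks in a block above all the finite ones.
  let s (v : V) : WithTop Ordinal.{u} := if v ∈ S then ((N + 1 : ℕ) * a + c v : Ordinal.{u}) else ⊤
  have s_of_mem {v : V} (hv : v ∈ S) : s v = ((N + 1 : ℕ) * a + c v : Ordinal.{u}) := if_pos hv
  have lift_s_le {v v' : V} (hv : v ∈ S) (hv' : v' ∈ S) (h : v ∈ F ∨ c v' < c v) :
      ((G.rank ⊓ s) v').map (G.lift v) ≤ s v := by
    refine (WithTop.monotone_map_iff.2 (G.lift v).monotone inf_le_right).trans ?_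
    rw [s_of_mem hv, s_of_mem hv', WithTop.map_coe, WithTop.coe_le_coe]
    exact buchiLift_block_add_le (hc v' hv') h
  have lift_rank_le {v v' : V} (hv : v ∈ S) (hv' : G.rank v' ≠ ⊤) :
      ((G.rank ⊓ s) v').map (G.lift v) ≤ s v := by
    refine (WithTop.monotone_map_iff.2 (G.lift v).monotone inf_le_left).trans ?_
    obtain ⟨o, ho⟩ := WithTop.ne_top_iff_exists.1 hv'
    rw [s_of_mem hv, ← ho, WithTop.map_coe, WithTop.coe_le_coe]
    exact (buchiLift_le_of_lt (rank_lt v' o ho.symm)).trans le_self_add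
  have valueStep_le_s : G.valueStep (G.rank ⊓ s) ≤ s := by
    intro v
    by_cases hv : v ∈ S
    · refine RankingGame.valueStep_le (fun ho => ?_) (fun ho v' he => ?_)
      · obtain ⟨v', hv', he, h⟩ := heve v hv ho
        exact ⟨v', he, lift_s_le hv hv' h⟩
      · rcases hadam v hv (Player.ne_eve_iff.1 ho) v' he with htop | ⟨hv', h⟩
        · exact lift_rank_le hv htop
        · exact lift_s_le hv hv' h
    · simp only [s, hv, if_false, le_top]
  have rank_le_s : G.rank ≤ s :=
    (RankingGame.rank_le (le_inf
      ((G.valueStep.monotone inf_le_left).trans_eq G.valueStep_rank) valueStep_le_s)).trans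
      inf_le_right
  intro v hv htop
  have hle := rank_le_s v
  rw [htop, s_of_mem hv, top_le_iff] at hle
  exact WithTop.coe_ne_top hle

end Arena

theorem lt_of_map_succ_le {α : Type*} [LinearOrder α] [SuccOrder α] [NoMaxOrder α]
    {r r' : WithTop α} (htop : r' ≠ ⊤) (h : r.map Order.succ ≤ r') : r < r' := by
  cases r with
  | top => exact absurd (top_le_iff.1 h) htop
  | coe o =>
    rw [WithTop.map_coe] at h
    exact (WithTop.coe_lt_coe.2 (Order.lt_succ o)).trans_le h

namespace Arena

variable {V : Type u} {A : Arena V} {F : Set V} {N : ℕ} {L : Set V}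

/-- The game on vertices and budgets in which Adam tries to force the budget to be exceeded while
the play stays in `L`. The positions at which he has succeeded are dead ends of Eve, and the ranks
count the remaining steps. -/
noncomputable def budgetGame (A : Arena V) (F : Set V) (N : ℕ) (L : Set V) :
    RankingGame (V × ℕ) where
  IsMin x := A.owner x.1 = Player.adam ∧ ¬ BudgetExceeded F x.1 x.2
  moves x := {y | ¬ BudgetExceeded F x.1 x.2 ∧ A.Edge x.1 y.1 ∧ y.1 ∈ L ∧
    y.2 = nextBudget F N x.1 x.2}
  lift _ := ⟨Order.succ, Order.succ_mono⟩

variable {v v' : V} {c : ℕ}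

theorem budgetGame_rank_ne_top_of_budgetExceeded (h : BudgetExceeded F v c) :
    (A.budgetGame F N L).rank (v, c) ≠ ⊤ :=
  (RankingGame.rank_ne_top_iff_of_not_isMin (G := A.budgetGame F N L) fun hmin => hmin.2 h).2
    fun _ hy => absurd h hy.1

theorem budgetGame_rank_ne_top_of_adam (ho : A.owner v = Player.adam) (he : A.Edge v v')
    (hv' : v' ∈ L) (h : (A.budgetGame F N L).rank (v', nextBudget F N v c) ≠ ⊤) :
    (A.budgetGame F N L).rank (v, c) ≠ ⊤ := by
  by_cases hex : BudgetExceeded F v c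
  · exact budgetGame_rank_ne_top_of_budgetExceeded hex
  · exact (RankingGame.rank_ne_top_iff_of_isMin (G := A.budgetGame F N L) ⟨ho, hex⟩).2
      ⟨(v', _), ⟨hex, he, hv', rfl⟩, h⟩

theorem budgetGame_rank_ne_top_of_eve (ho : A.owner v = Player.eve)
    (h : ¬ BudgetExceeded F v c → ∀ v' ∈ L, A.Edge v v' →
      (A.budgetGame F N L).rank (v', nextBudget F N v c) ≠ ⊤) :
    (A.budgetGame F N L).rank (v, c) ≠ ⊤ := by
  refine (RankingGame.rank_ne_top_iff_of_not_isMin (G := A.budgetGame F N L) fun hmin => ?_).2 ?_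
  · exact Player.ne_eve_iff.2 hmin.1 ho
  · rintro ⟨v', _⟩ ⟨hex, he, hv', rfl⟩
    exact h hex v' hv' he

theorem exists_mem_and_budgetGame_rank_lt_of_adam (hL : A.IsTrap Player.eve L) (hv : v ∈ L)
    (ho : A.owner v = Player.adam) (htop : (A.budgetGame F N L).rank (v, c) ≠ ⊤) :
    ∃ v', A.Edge v v' ∧ v' ∈ L ∧ (¬ BudgetExceeded F v c →
      (A.budgetGame F N L).rank (v', nextBudget F N v c) < (A.budgetGame F N L).rank (v, c)) := by
  by_cases hex : BudgetExceeded F v c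
  · obtain ⟨v', hv', he⟩ := (hL v hv).2 (Player.ne_eve_iff.2 ho)
    exact ⟨v', he, hv', absurd hex⟩
  · obtain ⟨⟨v', _⟩, ⟨-, he, hv', rfl⟩, hle⟩ :=
      RankingGame.exists_map_lift_rank_le (G := A.budgetGame F N L) ⟨ho, hex⟩ htop
    exact ⟨v', he, hv', fun _ => lt_of_map_succ_le htop hle⟩

theorem budgetGame_rank_lt_of_eve (ho : A.owner v = Player.eve) (hex : ¬ BudgetExceeded F v c)
    (htop : (A.budgetGame F N L).rank (v, c) ≠ ⊤) (he : A.Edge v v') (hv' : v' ∈ L) :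
    (A.budgetGame F N L).rank (v', nextBudget F N v c) < (A.budgetGame F N L).rank (v, c) :=
  lt_of_map_succ_le htop <|
    RankingGame.map_lift_rank_le (G := A.budgetGame F N L) (x := (v, c)) (y := (v', _))
      (fun hmin => Player.ne_eve_iff.2 hmin.1 ho) ⟨hex, he, hv', rfl⟩

theorem exists_budgetMemory_adamWins (hL : A.IsTrap Player.eve L)
    (hr : ∀ v ∈ L, ∀ c ≤ N, (A.budgetGame F N L).rank (v, c) ≠ ⊤) :
    ∃ τ : A.Strategy Player.adam, τ.UsesMemory (budgetMemory F N) ∧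
      A.AdamWins (uniformBuchi F N) τ L := by
  set ρ := (A.budgetGame F N L).rank
  choose f hf using fun c : ℕ => A.exists_legal_choice fun v v' =>
    v' ∈ L ∧ (¬ BudgetExceeded F v c → ρ (v', nextBudget F N v c) < ρ (v, c))
  let τ : A.Strategy Player.adam :=
    ⟨fun h v => f ((budgetMemory F N).state h v) v, fun h v _ => (hf _ v).1⟩
  refine ⟨τ, ⟨fun v c => f c v, fun _ _ _ => rfl⟩, fun v₀ hv₀ σ => ?_⟩
  set π := A.play σ τ v₀
  let c := budget F N π
  have step (k : ℕ) (hk : π k ∈ L) : π (k + 1) ∈ L ∧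
      (¬ BudgetExceeded F (π k) (c k) → ρ (π (k + 1), c (k + 1)) < ρ (π k, c k)) := by
    have he := edge_play σ τ v₀ k
    have htop := hr _ hk (c k) (budget_le π k)
    cases ho : A.owner (π k) with
    | eve =>
      have hmem := (hL _ hk).1 ho _ he
      exact ⟨hmem, fun hex => budgetGame_rank_lt_of_eve ho hex htop he hmem⟩
    | adam =>
      have hmove : π (k + 1) = f (c k) (π k) :=
        (play_succ_of_adam ho).trans
          (congrArg (f · (π k)) (state_budgetMemory_eq_budget σ τ v₀ k))
      rw [hmove]
      exact (hf (c k) (π k)).2 (exists_mem_and_budgetGame_rank_lt_of_adam hL hk ho htop)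
  have mem_L (k : ℕ) : π k ∈ L := by
    induction k with
    | zero => exact hv₀
    | succ k ih => exact (step k ih).1
  refine notMem_uniformBuchi_of_frequently_budgetExceeded fun hev => ?_
  obtain ⟨k₀, hk₀⟩ := eventually_atTop.1 hev
  exact not_strictAnti_of_wellFoundedLT (fun k => ρ (π (k₀ + k), c (k₀ + k)))
    (strictAnti_nat_of_succ_lt fun k => (step _ (mem_L _)).2 (hk₀ _ (Nat.le_add_right _ _)))

theorem budgetGame_rank_ne_top_of_rank_eq_top :
    ∀ v ∈ {v | (A.buchiGame F N).rank v = ⊤}, ∀ c ≤ N,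
      (A.budgetGame F N {v | (A.buchiGame F N).rank v = ⊤}).rank (v, c) ≠ ⊤ := by
  classical
  set L := {v | (A.buchiGame F N).rank v = ⊤}
  set ρ := (A.budgetGame F N L).rank
  let S : Set V := {v | v ∈ L ∧ ∃ c ≤ N, ρ (v, c) = ⊤}
  let safe (v : V) : ℕ := sInf {c | c ≤ N ∧ ρ (v, c) = ⊤}
  have safe_spec {v : V} (hv : v ∈ S) : safe v ≤ N ∧ ρ (v, safe v) = ⊤ := Nat.sInf_mem hv.2
  have not_exceeded {v : V} (hv : v ∈ S) : ¬ BudgetExceeded F v (safe v) := fun hex =>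
    budgetGame_rank_ne_top_of_budgetExceeded hex (safe_spec hv).2
  have step {v v' : V} (hv : v ∈ S) (hv' : v' ∈ L)
      (htop : ρ (v', nextBudget F N v (safe v)) = ⊤) : v' ∈ S ∧ (v ∈ F ∨ safe v' < safe v) := by
    have hle : nextBudget F N v (safe v) ≤ N := nextBudget_le (safe_spec hv).1
    refine ⟨⟨hv', _, hle, htop⟩, or_iff_not_imp_left.2 fun hF => ?_⟩
    have hpos : safe v ≠ 0 := fun h => not_exceeded hv ⟨hF, h⟩
    have hsafe : safe v' ≤ nextBudget F N v (safe v) := Nat.sInf_le ⟨hle, htop⟩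
    rw [nextBudget_of_notMem hF hpos] at hsafe
    omega
  intro v hvL c hc htop
  refine rank_ne_top_of_counter (S := S) safe (fun v hv => (safe_spec hv).1) (fun v hv ho => ?_)
    (fun v hv ho v' he => or_iff_not_imp_left.2 fun hr => ?_) v ⟨hvL, c, hc, htop⟩ hvL
  · obtain ⟨v', hv', he, htop'⟩ : ∃ v' ∈ L, A.Edge v v' ∧
        ρ (v', nextBudget F N v (safe v)) = ⊤ := by
      by_contra! hno
      exact budgetGame_rank_ne_top_of_eve ho (fun _ => hno) (safe_spec hv).2
    exact ⟨v', (step hv hv' htop').1, he, (step hv hv' htop').2⟩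
  · have hv' : v' ∈ L := not_not.1 hr
    exact step hv hv' (by_contra fun htop' =>
      budgetGame_rank_ne_top_of_adam ho he hv' htop' (safe_spec hv).2)

variable (A F N) in
theorem exists_uniformBuchi_strategies :
    (∃ σ : A.Strategy Player.eve, σ.IsPositional ∧
        A.EveWins (uniformBuchi F N) σ (A.eveWinningSet (uniformBuchi F N))) ∧
      ∃ τ : A.Strategy Player.adam, τ.UsesMemory (budgetMemory F N) ∧
        A.AdamWins (uniformBuchi F N) τ (A.adamWinningSet (uniformBuchi F N)) := by
  obtain ⟨σ, hpos, hσ⟩ := exists_positional_eveWins A F N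
  obtain ⟨τ, hmem, hτ⟩ := exists_budgetMemory_adamWins (isTrap_eve_rank_eq_top A F N)
    budgetGame_rank_ne_top_of_rank_eq_top
  have compl_eq : {v | (A.buchiGame F N).rank v = ⊤} = {v | (A.buchiGame F N).rank v ≠ ⊤}ᶜ :=
    Set.ext fun _ => not_not.symm
  obtain ⟨heve, hadam⟩ := eveWinningSet_eq_and_adamWinningSet_eq hσ (compl_eq ▸ hτ)
  exact ⟨⟨σ, hpos, heve ▸ hσ⟩, τ, hmem, hadam ▸ compl_eq ▸ hτ⟩

end Arena

/-- The vertices of the arena on which Adam needs `n + 1` memory states for the bound `n + 2`. At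
`wait 0` Adam picks a number `i`, and Eve answers `choice i` either by visiting `reset i`, after
which she has to come back along `wait (i + 1), …, wait 0`, or by a detour to `detour 0`, which is
the longer the smaller `i` is. -/
inductive DelayVertex (n : ℕ) : Type where
  | wait (k : Fin (n + 2))
  | choice (i : Fin (n + 1))
  | reset (i : Fin (n + 1))
  | detour (k : Fin (n + 2))

namespace DelayVertex

variable {n : ℕ}

instance : Finite (DelayVertex n) := by
  refine .of_surjective (Sum.elim (Sum.elim wait choice) (Sum.elim reset detour)) ?_
  rintro (k | i | i | k)
  exacts [⟨.inl (.inl k), rfl⟩, ⟨.inl (.inr i), rfl⟩, ⟨.inr (.inl i), rfl⟩, ⟨.inr (.inr k), rfl⟩]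

/-- The edges of the delay arena. -/
inductive Edge : DelayVertex n → DelayVertex n → Prop where
  | wait_wait {k l : Fin (n + 2)} (h : (k : ℕ) = l + 1) : Edge (wait k) (wait l)
  | wait_choice (i : Fin (n + 1)) : Edge (wait 0) (choice i)
  | choice_reset (i : Fin (n + 1)) : Edge (choice i) (reset i)
  | choice_detour {i : Fin (n + 1)} {k : Fin (n + 2)} (h : (i : ℕ) + k = n + 1) :
      Edge (choice i) (detour k)
  | reset_wait (i : Fin (n + 1)) : Edge (reset i) (wait i.succ)
  | detour_detour {k l : Fin (n + 2)} (h : (k : ℕ) = l + 1) : Edge (detour k) (detour l)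
  | detour_wait : Edge (detour 0) (wait 0)

theorem exists_edge : ∀ v : DelayVertex n, ∃ v', Edge v v'
  | wait k => by
    induction k using Fin.cases with
    | zero => exact ⟨choice 0, .wait_choice 0⟩
    | succ k => exact ⟨wait k.castSucc, .wait_wait rfl⟩
  | choice i => ⟨reset i, .choice_reset i⟩
  | reset i => ⟨wait i.succ, .reset_wait i⟩
  | detour k => by
    induction k using Fin.cases with
    | zero => exact ⟨wait 0, .detour_wait⟩
    | succ k => exact ⟨detour k.castSucc, .detour_detour rfl⟩

/-- The arena on `DelayVertex n`, in which Eve controls the vertices `choice i`. -/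
def arena (n : ℕ) : Arena (DelayVertex n) where
  owner
    | choice _ => Player.eve
    | _ => Player.adam
  Edge := Edge
  exists_edge := exists_edge

/-- The Büchi set of the delay arena. -/
def target (n : ℕ) : Set (DelayVertex n) :=
  {v | v = detour 0 ∨ ∃ i, v = reset i}

@[simp] theorem wait_notMem_target (k : Fin (n + 2)) : wait k ∉ target n := by simp [target]

@[simp] theorem choice_notMem_target (i : Fin (n + 1)) : choice i ∉ target n := by simp [target]

@[simp] theorem reset_mem_target (i : Fin (n + 1)) : reset i ∈ target n := .inr ⟨i, rfl⟩

@[simp] theorem detour_mem_target_iff {k : Fin (n + 2)} : detour k ∈ target n ↔ k = 0 := by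
  simp [target]

section Adam

/-- Adam can force the budget `c` to be exceeded from the vertex `v` of the delay arena. -/
def CanExceed (v : DelayVertex n) (c : ℕ) : Prop :=
  ((arena n).budgetGame (target n) (n + 2) Set.univ).rank (v, c) ≠ ⊤

variable {v v' : DelayVertex n} {c : ℕ}

theorem canExceed_zero (hv : v ∉ target n) : CanExceed v 0 :=
  Arena.budgetGame_rank_ne_top_of_budgetExceeded ⟨hv, rfl⟩

theorem CanExceed.of_notMem (h : CanExceed v' c) (hv : v ∉ target n)
    (ho : (arena n).owner v = Player.adam) (he : Edge v v') : CanExceed v (c + 1) := by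
  refine Arena.budgetGame_rank_ne_top_of_adam ho he trivial ?_
  rwa [nextBudget_of_notMem hv c.succ_ne_zero]

theorem CanExceed.of_mem (h : CanExceed v' (n + 2)) (hv : v ∈ target n)
    (ho : (arena n).owner v = Player.adam) (he : Edge v v') : CanExceed v c := by
  refine Arena.budgetGame_rank_ne_top_of_adam ho he trivial ?_
  rwa [nextBudget_of_mem hv]

theorem canExceed_wait {k : Fin (n + 2)} (h : CanExceed (wait (0 : Fin (n + 2))) (c - k)) :
    CanExceed (wait k) c := by
  induction k using Fin.induction generalizing c with
  | zero => exact h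
  | succ k ih =>
    cases c with
    | zero => exact canExceed_zero (wait_notMem_target _)
    | succ c =>
      refine (ih ?_).of_notMem (wait_notMem_target _) rfl (.wait_wait rfl)
      simpa using h

theorem canExceed_reset {i : Fin (n + 1)}
    (h : CanExceed (wait (0 : Fin (n + 2))) (n + 1 - i)) : CanExceed (reset i) c :=
  CanExceed.of_mem (canExceed_wait (by simpa using h)) (reset_mem_target i) rfl (.reset_wait i)

theorem canExceed_detour {k : Fin (n + 2)}
    (h : c < k ∨ CanExceed (wait (0 : Fin (n + 2))) (n + 2)) : CanExceed (detour k) c := by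
  induction k using Fin.induction generalizing c with
  | zero => exact (h.resolve_left (Nat.not_lt_zero c)).of_mem (by simp) rfl .detour_wait
  | succ k ih =>
    have hk : detour k.succ ∉ target n := by simp
    cases c with
    | zero => exact canExceed_zero hk
    | succ c => exact (ih (by simpa using h)).of_notMem hk rfl (.detour_detour rfl)

theorem canExceed_choice {i : Fin (n + 1)} (hreset : CanExceed (reset i) (c - 1))
    (hdetour : ∀ k : Fin (n + 2), (i : ℕ) + k = n + 1 → CanExceed (detour k) (c - 1)) :
    CanExceed (choice i) c := by
  refine Arena.budgetGame_rank_ne_top_of_eve rfl fun hex v' _ he => ?_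
  rw [nextBudget_of_notMem (choice_notMem_target i)
    fun hc => hex ⟨choice_notMem_target i, hc⟩]
  cases he with
  | choice_reset => exact hreset
  | choice_detour h => exact hdetour _ h

theorem canExceed_wait_zero (hc : c ≤ n + 2) : CanExceed (wait (0 : Fin (n + 2))) c := by
  induction c with
  | zero => exact canExceed_zero (wait_notMem_target 0)
  | succ c ih =>
    obtain ⟨i, hi⟩ : ∃ i, CanExceed (choice i : DelayVertex n) c := by
      rcases Nat.eq_zero_or_pos c with rfl | hpos
      · exact ⟨0, canExceed_zero (choice_notMem_target 0)⟩
      · let i : Fin (n + 1) := ⟨n + 1 - c, by omega⟩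
        have hi : n + 1 - (i : ℕ) = c := by simp only [i]; omega
        refine ⟨i, canExceed_choice (canExceed_reset (hi ▸ ih (by omega)))
          fun k hk => canExceed_detour (.inl (by omega))⟩
    exact hi.of_notMem (wait_notMem_target 0) rfl (.wait_choice i)

theorem canExceed (v : DelayVertex n) (hc : c ≤ n + 2) : CanExceed v c := by
  have hwait {c : ℕ} (hc : c ≤ n + 2) := canExceed_wait_zero hc
  have hreset (i : Fin (n + 1)) (c : ℕ) : CanExceed (reset i) c :=
    canExceed_reset (hwait (by omega))
  have hdetour (k : Fin (n + 2)) (c : ℕ) : CanExceed (detour k) c :=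
    canExceed_detour (.inr (hwait le_rfl))
  cases v with
  | wait k => exact canExceed_wait (hwait (by omega))
  | choice i => exact canExceed_choice (hreset i _) fun k _ => hdetour k _
  | reset i => exact hreset i c
  | detour k => exact hdetour k c

theorem wait_zero_mem_adamWinningSet :
    wait 0 ∈ (arena n).adamWinningSet (uniformBuchi (target n) (n + 2)) := by
  have trap_univ : (arena n).IsTrap Player.eve Set.univ := fun v _ =>
    ⟨fun _ _ _ => trivial, fun _ => ((arena n).exists_edge v).imp fun _ he => ⟨trivial, he⟩⟩
  obtain ⟨τ, -, hτ⟩ := Arena.exists_budgetMemory_adamWins trap_univ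
    fun v _ _ hc => canExceed v hc
  exact ⟨τ, fun v₀ _ => hτ v₀ trivial⟩

end Adam

section Eve

/-- The vertices visited if Adam never picks `j` and Eve answers `choice i` by `reset i` if `i < j`,
and by the detour if `j < i`. -/
def AvoidsDelay (j : Fin (n + 1)) : DelayVertex n → Prop
  | wait k => (k : ℕ) ≤ j
  | choice i => i ≠ j
  | reset i => i < j
  | detour _ => True

/-- A bound on the time until the next visit to the Büchi set under the strategy described at
`AvoidsDelay`. -/
def stepsToTarget (j : Fin (n + 1)) : DelayVertex n → ℕ
  | wait k => n + 2 - j + k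
  | choice _ => n + 1 - j
  | reset _ => 0
  | detour k => k

/-- A move which respects `AvoidsDelay` and decreases the bound `stepsToTarget`. -/
def IsSafeMove (j : Fin (n + 1)) (v v' : DelayVertex n) : Prop :=
  AvoidsDelay j v' ∧ (v ∈ target n ∨ stepsToTarget j v' < stepsToTarget j v)

variable {j : Fin (n + 1)} {v v' : DelayVertex n}

theorem stepsToTarget_le (hv : AvoidsDelay j v) : stepsToTarget j v ≤ n + 2 := by
  cases v <;> simp only [AvoidsDelay, stepsToTarget] at hv ⊢ <;> omega

theorem eq_wait_zero_of_edge_choice {i : Fin (n + 1)} (h : Edge v (choice i)) : v = wait 0 := by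
  cases h
  rfl

theorem exists_isSafeMove_of_eve (ho : (arena n).owner v = Player.eve) (hv : AvoidsDelay j v) :
    ∃ v', Edge v v' ∧ IsSafeMove j v v' := by
  cases v with
  | choice i =>
    rcases lt_or_gt_of_ne hv with hlt | hgt
    · exact ⟨reset i, .choice_reset i, hlt, .inr (Nat.sub_pos_of_lt j.is_lt)⟩
    · let k : Fin (n + 2) := ⟨n + 1 - i, by omega⟩
      exact ⟨detour k, .choice_detour (by simp only [k]; omega), trivial,
        .inr (by simp only [stepsToTarget, k]; omega)⟩
  | _ => cases ho

theorem isSafeMove_of_edge (he : Edge v v') (ho : (arena n).owner v = Player.adam)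
    (hv : AvoidsDelay j v) (hv' : v' ≠ choice j) : IsSafeMove j v v' := by
  cases he with
  | wait_wait h =>
    simp only [IsSafeMove, AvoidsDelay, stepsToTarget] at hv ⊢
    exact ⟨by omega, .inr (by omega)⟩
  | wait_choice i =>
    refine ⟨fun h => hv' (congrArg choice h), .inr ?_⟩
    simp only [stepsToTarget]
    omega
  | choice_reset => cases ho
  | choice_detour => cases ho
  | reset_wait i => exact ⟨hv, .inl (reset_mem_target i)⟩
  | detour_detour h => exact ⟨trivial, .inr (by simp only [stepsToTarget]; omega)⟩
  | detour_wait => exact ⟨Nat.zero_le _, .inl (detour_mem_target_iff.2 rfl)⟩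

theorem exists_next_eq_choice {τ : (arena n).Strategy Player.adam}
    (hτ : (arena n).AdamWins (uniformBuchi (target n) (n + 2)) τ {wait 0}) (j : Fin (n + 1)) :
    ∃ h, τ.next h (wait 0) = choice j := by
  by_contra! never_picked
  obtain ⟨f, hf⟩ := (arena n).exists_legal_choice (IsSafeMove j)
  let σ : (arena n).Strategy Player.eve := ⟨fun _ => f, fun _ v _ => (hf v).1⟩
  set π := (arena n).play σ τ (wait 0)
  have safe_step (k : ℕ) (hk : AvoidsDelay j (π k)) : IsSafeMove j (π k) (π (k + 1)) := by
    have he : Edge (π k) (π (k + 1)) := Arena.edge_play σ τ _ k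
    cases ho : (arena n).owner (π k) with
    | eve =>
      have hmove : π (k + 1) = f (π k) := Arena.play_succ_of_eve ho
      rw [hmove]
      exact (hf (π k)).2 (exists_isSafeMove_of_eve ho hk)
    | adam =>
      have hmove : π (k + 1) = τ.next _ (π k) := Arena.play_succ_of_adam ho
      refine isSafeMove_of_edge he ho hk fun hpick => ?_
      have hwait : π k = wait 0 := eq_wait_zero_of_edge_choice (hpick ▸ he)
      exact never_picked _ (by rw [← hwait, ← hmove, hpick])
  have avoids (k : ℕ) : AvoidsDelay j (π k) := by
    induction k with
    | zero => exact Nat.zero_le _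
    | succ k ih => exact (safe_step k ih).1
  exact hτ _ rfl σ <| mem_uniformBuchi_of_counter (fun k => stepsToTarget j (π k))
    (.of_forall fun k => stepsToTarget_le (avoids k))
    (.of_forall fun k => (safe_step k (avoids k)).2)

theorem le_card_memory {M : Type w} [Fintype M] {μ : MemoryStructure (DelayVertex n) M}
    {τ : (arena n).Strategy Player.adam} (hμ : τ.UsesMemory μ)
    (hτ : (arena n).AdamWins (uniformBuchi (target n) (n + 2)) τ {wait 0}) :
    n + 1 ≤ Fintype.card M := by
  obtain ⟨ν, hν⟩ := hμ
  choose h hh using exists_next_eq_choice hτ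
  have state_injective : Function.Injective fun j => μ.state (h j) (wait 0) := by
    intro i j hij
    have hchoice : choice i = choice j := by
      rw [← hh i, ← hh j, hν _ _ rfl, hν _ _ rfl]
      exact congrArg (ν (wait 0)) hij
    exact choice.inj hchoice
  simpa using Fintype.card_le_of_injective _ state_injective

end Eve

end DelayVertex

theorem mainTheorem3_general :
    (∀ (V : Type u) (A : Arena V) (F : Set V) (N : ℕ),
      (∃ σ : A.Strategy Player.eve, σ.IsPositional ∧
        A.EveWins (uniformBuchi F N) σ (A.eveWinningSet (uniformBuchi F N))) ∧
      (∃ (μ : MemoryStructure V (Fin (N + 1))) (τ : A.Strategy Player.adam), τ.UsesMemory μ ∧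
        A.AdamWins (uniformBuchi F N) τ (A.adamWinningSet (uniformBuchi F N)))) ∧
    (∀ N : ℕ, 2 ≤ N →
      ∃ (V : Type) (_ : Finite V) (A : Arena V) (F : Set V),
        ∃ v₀ ∈ A.adamWinningSet (uniformBuchi F N),
          ∀ (M : Type w) [Fintype M] (μ : MemoryStructure V M) (τ : A.Strategy Player.adam),
            τ.UsesMemory μ → A.AdamWins (uniformBuchi F N) τ {v₀} →
              N - 1 ≤ Fintype.card M) := by
  refine ⟨fun V A F N => ?_, fun N hN => ?_⟩
  · obtain ⟨heve, hadam⟩ := A.exists_uniformBuchi_strategies F N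
    exact ⟨heve, budgetMemory F N, hadam⟩
  · obtain ⟨n, rfl⟩ := Nat.exists_eq_add_of_le' hN
    exact ⟨DelayVertex n, inferInstance, DelayVertex.arena n, DelayVertex.target n,
      DelayVertex.wait 0, DelayVertex.wait_zero_mem_adamWinningSet,
      fun _ _ _ _ hμ hτ => DelayVertex.le_card_memory hμ hτ⟩

theorem mainTheorem3 :
    (∀ (V : Type u) [Countable V] (A : Arena V) (F : Set V) (N : ℕ),
      (∃ σ : A.Strategy Player.eve, σ.IsPositional ∧
        A.EveWins (uniformBuchi F N) σ (A.eveWinningSet (uniformBuchi F N))) ∧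
      (∃ (μ : MemoryStructure V (Fin (N + 1))) (τ : A.Strategy Player.adam), τ.UsesMemory μ ∧
        A.AdamWins (uniformBuchi F N) τ (A.adamWinningSet (uniformBuchi F N)))) ∧
    (∀ N : ℕ, 2 ≤ N →
      ∃ (V : Type) (_ : Finite V) (A : Arena V) (F : Set V),
        ∃ v₀ ∈ A.adamWinningSet (uniformBuchi F N),
          ∀ (M : Type w) [Fintype M] (μ : MemoryStructure V M) (τ : A.Strategy Player.adam),
            τ.UsesMemory μ → A.AdamWins (uniformBuchi F N) τ {v₀} →
              N - 1 ≤ Fintype.card M) :=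
  ⟨fun V _ => mainTheorem3_general.{u, w}.1 V, mainTheorem3_general.{u, w}.2⟩
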